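/- For a prime $p$, integers $d\ge 1$ and $k_1,\dots,k_d\ge 1$, put \[ H_p(k_1,\dots,k_d)=\sum_{0<n_1<\cdots<n_d<p} n_1^{-k_1}\cdots n_d^{-k_d},\qquad H_p^{\star}(k_1,\dots,k_d)=\sum_{0<n_1\le\cdots\le n_d<p} n_1^{-k_1}\cdots n_d^{-k_d} \] in $\mathbb{F}_p=\mathbb{Z}/p\mathbb{Z}$. Let $\mathcal{A}=\prod_p\mathbb{F}_p\big/\bigoplus_p\mathbb{F}_p$, where $p$ runs over all primes, and let $\zeta_{\mathcal{A}}(k_1,\dots,k_d)$ and $\zeta_{\mathcal{A}}^{\star}(k_1,\dots,k_d)$ be the classes in $\mathcal{A}$ of $(H_p(k_1,\dots,k_d))_p$ and $(H_p^{\star}(k_1,\dots,k_d))_p$, respectively. Let $k$ be a positive integer, $d$ a positive odd integer, and $i$ an integer with $1\le i\le d$. Then \[ \sum_{\substack{k_1,\dots,k_d\ge 1\\ k_1+\cdots+k_d=k}} 2^{k_i}\,\zeta_{\mathcal{A}}(k_1,\dots,k_d)=0 \qquad\text{and}\qquad \sum_{\substack{k_1,\dots,k_d\ge 1\\ k_1+\cdots+k_d=k}}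 2^{k_i}\,\zeta_{\mathcal{A}}^{\star}(k_1,\dots,k_d)=0 \] in $\mathcal{A}$. -/

import Mathlib

namespace FiniteMZV

/-- The ideal `⨁_p 𝔽_p` of `∏_p 𝔽_p`: the families, indexed by the primes, all but finitely many of
whose components are zero. -/
def directSumIdeal : Ideal (∀ p : Nat.Primes, ZMod (p : ℕ)) where
  carrier := {f | {p | f p ≠ 0}.Finite}
  zero_mem' := by simp
  add_mem' := by
    intro f g hf hg
    refine (hf.union hg).subset ?_
    intro p hp
    by_contra h
    simp only [Set.mem_union, Set.mem_ofPred_eq, not_or, not_not] at h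
    exact hp (by simp [h.1, h.2])
  smul_mem' := by
    intro c f hf
    refine hf.subset ?_
    intro p hp h
    exact hp (by simp [h])

/-- The ring `𝒜 = ∏_p 𝔽_p / ⨁_p 𝔽_p`, where `p` runs over all primes. -/
abbrev A : Type := (∀ p : Nat.Primes, ZMod (p : ℕ)) ⧸ directSumIdeal

open Classical in
/-- `H_p(k_1, …, k_d) = ∑_{0 < n_1 < ⋯ < n_d < p} n_1^{-k_1} ⋯ n_d^{-k_d}` in `ℤ/pℤ`. -/
noncomputable def harmonicSum (p : ℕ) {d : ℕ} (k : Fin d → ℕ) : ZMod p :=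
  ∑ n ∈ (Fintype.piFinset fun _ : Fin d => Finset.Ioo 0 p) with StrictMono n,
    ∏ j, ((n j : ZMod p)⁻¹) ^ k j

open Classical in
/-- `H_p^⋆(k_1, …, k_d) = ∑_{0 < n_1 ≤ ⋯ ≤ n_d < p} n_1^{-k_1} ⋯ n_d^{-k_d}` in `ℤ/pℤ`. -/
noncomputable def harmonicSumStar (p : ℕ) {d : ℕ} (k : Fin d → ℕ) : ZMod p :=
  ∑ n ∈ (Fintype.piFinset fun _ : Fin d => Finset.Ioo 0 p) with Monotone n,
    ∏ j, ((n j : ZMod p)⁻¹) ^ k j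

/-- The finite multiple zeta value `ζ_𝒜(k_1, …, k_d) = (H_p(k_1, …, k_d))_p`. -/
noncomputable def zetaA {d : ℕ} (k : Fin d → ℕ) : A :=
  Ideal.Quotient.mk directSumIdeal fun p => harmonicSum (p : ℕ) k

/-- The finite multiple zeta-star value `ζ_𝒜^⋆(k_1, …, k_d) = (H_p^⋆(k_1, …, k_d))_p`. -/
noncomputable def zetaAStar {d : ℕ} (k : Fin d → ℕ) : A :=
  Ideal.Quotient.mk directSumIdeal fun p => harmonicSumStar (p : ℕ) k

/-- The set of all `(k_1, …, k_d)` with `k_1, …, k_d ≥ 1` and `k_1 + ⋯ + k_d = k`. -/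
def indices (k d : ℕ) : Finset (Fin d → ℕ) :=
  {κ ∈ Finset.piAntidiag Finset.univ k | ∀ j, 1 ≤ κ j}

theorem mem_indices {k d : ℕ} {κ : Fin d → ℕ} :
    κ ∈ indices k d ↔ (∀ j, 1 ≤ κ j) ∧ ∑ j, κ j = k := by
  simp [indices, and_comm]

end FiniteMZV

/-!
Fix an odd prime `p`, and in `𝔽_p⟦x⟧` put `f n = ∑_{k ≥ 1} n^{-k} x^k = x / (n - x)` and
`g n = 2 x / (n - 2 x)`. For `d = r + 1 + s` and the marked position `r` (counted from zero), the
weighted sum of the `H_p(κ)` over all `κ` of weight `k` is the coefficient of `x ^ k` in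
`E r s = ∑_m g m * e_r(f n : n < m) * e_s(f n : n > m)`, where `e_r` is the elementary symmetric
polynomial. It suffices to show that `x ^ (p - 1)` divides `E r s` when `r + s` is even: then all
primes `p > k + 1` contribute zero.

With two further variables, `W α β = ∑ α ^ r β ^ s E r s` equals
`∑_m g m ∏_{n < m} (1 + α f n) ∏_{n > m} (1 + β f n)`, and the claim becomes
`x ^ (p - 1) ∣ W α β + W (-α) (-β)`. After clearing denominators, `W` is expressed through
`c_m = ∏_{n < m} (n + u) ∏_{n > m} (n + v)` with `u = (α - 1) x`, `v = (β - 1) x`, `z = 2 x`,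
namely through `C = ∑ c_m`, which telescopes, and `T = ∑ c_m ∏_{n ≠ m} (n - z)`. The change of sign
`(α, β) ↦ (-α, -β)` becomes the reflection `(u, v) ↦ (-z - u, -z - v)`. The heart of the proof is
the identity (`splitSumErase_reflect`)
`z (u - v) (T (u, v) + T (-z - u, -z - v)) = ∏ (n - z) * (D u - D v)`, where
`D w = (w + z) ^ (p - 1) - w ^ (p - 1)`.
Both sides satisfy the same first-order recurrence under `u ↦ u + 1`; in characteristic `p` the
`p`-th iterate of that shift is the identity, and going once around shows that the difference of the
two sides is killed by `(z ^ p - z) ((u - v) ^ p - (u - v))`. The right-hand sides that result are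
homogeneous of high degree in `x`, which gives the divisibility (`genSum_add_genSum_neg`).

For the star sums, the elementary symmetric polynomials are replaced by complete homogeneous ones,
over `n ≤ m` and `n ≥ m`. Since `∏_{0 < n < p} (1 + T f n) ≡ 1` modulo `x ^ (p - 1)`,
`h_r(f n : n ≤ m) ≡ (-1) ^ r e_r(f n : n > m)`, so the star sum for `(r, s)` is congruent to
`(-1) ^ (r + s) E s r`, and the second claim follows from the first.
-/

namespace FiniteMZV

open Finset Polynomial

/-! ### Products split at an index -/

section Ring
variable {R : Type*} [CommRing R]

/-- The product `∏_{0 < n < m} (n + u) * ∏_{m < n < p} (n + v)`, with the factor at `m` left out. -/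
def splitProd (p m : ℕ) (u v : R) : R :=
  (∏ n ∈ Ioo 0 m, ((n : R) + u)) * ∏ n ∈ Ioo m p, ((n : R) + v)

/-- The sum of `splitProd p m u v` over `0 < m < p`. -/
def splitSum (p : ℕ) (u v : R) : R := ∑ m ∈ Ioo 0 p, splitProd p m u v

/-- The sum of `splitProd p m u v / (m - z)` over `0 < m < p`, multiplied by
`∏_{0 < n < p} (n - z)` so that it makes sense in every ring. -/
def splitSumErase (p : ℕ) (u v z : R) : R :=
  ∑ m ∈ Ioo 0 p, splitProd p m u v * ∏ n ∈ (Ioo 0 p).erase m, ((n : R) - z)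

/-- The sum telescopes, since `u - v = (m + u) - (m + v)`. -/
theorem sub_mul_splitSum (p : ℕ) (u v : R) :
    (u - v) * splitSum p u v =
      ∏ n ∈ Ioo 0 p, ((n : R) + u) - ∏ n ∈ Ioo 0 p, ((n : R) + v) := by
  rcases Nat.eq_zero_or_pos p with rfl | hp
  · simp [splitSum]
  let F : ℕ → R := fun m => (∏ n ∈ Ico 1 m, ((n : R) + u)) * ∏ n ∈ Ico m p, ((n : R) + v)
  have hI : ∀ m, Ioo 0 m = Ico 1 m := fun m => by ext; simp; omega
  have hF : ∀ m ∈ Ico 1 p, (u - v) * splitProd p m u v = F (m + 1) - F m := by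
    intro m hm
    have hm := Finset.mem_Ico.mp hm
    have hI' : Ioo m p = Ico (m + 1) p := by ext; simp
    simp only [F, splitProd, hI, hI', prod_Ico_succ_top hm.1, prod_eq_prod_Ico_succ_bot hm.2]
    ring
  rw [splitSum, mul_sum, hI, sum_congr rfl hF, sum_Ico_sub F hp]
  simp [F]

theorem add_one_mul_splitProd {p m : ℕ} (hm : 1 ≤ m) (u v : R) :
    (u + 1) * splitProd p m (u + 1) v = (m + u) * splitProd p m u v := by
  obtain ⟨m, rfl⟩ : ∃ l, m = l + 1 := ⟨m - 1, by omega⟩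
  have hI : Ioo 0 (m + 1) = Ico 1 (m + 1) := by ext; simp; omega
  have key : ∀ m : ℕ, (u + 1) * ∏ n ∈ Ico 1 (m + 1), ((n : R) + (u + 1)) =
      ((m + 1 : ℕ) + u) * ∏ n ∈ Ico 1 (m + 1), ((n : R) + u) := by
    intro m
    induction m with
    | zero => simp; ring
    | succ m ih =>
      rw [prod_Ico_succ_top (by omega), ← mul_assoc, ih,
        prod_Ico_succ_top (show 1 ≤ m + 1 by omega) fun n => (n : R) + u]
      push_cast; ring
  rw [splitProd, splitProd, hI, ← mul_assoc, key, mul_assoc]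

/-- The contiguity relation in `u`; it comes from `(m + u) / (m - z) = 1 + (u + z) / (m - z)`. -/
theorem add_one_mul_splitSumErase (p : ℕ) (u v z : R) :
    (u + 1) * splitSumErase p (u + 1) v z =
      (∏ n ∈ Ioo 0 p, ((n : R) - z)) * splitSum p u v + (u + z) * splitSumErase p u v z := by
  simp only [splitSumErase, splitSum, mul_sum, ← sum_add_distrib]
  refine sum_congr rfl fun m hm => ?_
  rw [← mul_assoc, add_one_mul_splitProd (by simp at hm; omega), ← mul_prod_erase _ _ hm]
  ring

end Ring

section CharP
variable {R : Type*} [CommRing R] {p : ℕ} [hp : Fact p.Prime] [CharP R p]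

theorem prod_range_add_natCast (u : R) : ∏ n ∈ range p, (u + n) = u ^ p - u := by
  have hroots := FiniteField.roots_X_pow_card_sub_X (ZMod p)
  have hdeg := FiniteField.X_pow_card_sub_X_natDegree_eq (ZMod p) hp.out.one_lt
  rw [ZMod.card] at hroots
  have hmonic : (X ^ p - X : (ZMod p)[X]).Monic :=
    monic_X_pow_sub (by rw [degree_X]; exact_mod_cast hp.out.one_lt)
  have h := prod_multiset_X_sub_C_of_monic_of_roots_card_eq hmonic
    (by rw [hroots, hdeg]; simp [ZMod.card])
  rw [hroots] at h
  let _ := ZMod.algebra R p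
  have h' := congrArg (aeval u) h
  rw [Finset.prod_map_val, map_prod] at h'
  simp only [map_sub, map_pow, aeval_X, aeval_C] at h'
  rw [← h']
  refine prod_nbij (fun n => -(n : ZMod p)) (by simp) ?_ ?_ (by simp)
  · intro a ha b hb hab
    have := (ZMod.natCast_eq_natCast_iff' _ _ _).mp (neg_injective hab)
    rwa [Nat.mod_eq_of_lt (by simpa using ha), Nat.mod_eq_of_lt (by simpa using hb)] at this
  · intro a _
    exact ⟨(-a).val, by simpa using ZMod.val_lt (-a), by simp⟩

theorem prod_Ioo_natCast_add (u : R) : ∏ n ∈ Ioo 0 p, ((n : R) + u) = u ^ (p - 1) - 1 := by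
  have h := prod_range_add_natCast (p := p) (X : R[X])
  have hr : range p = insert 0 (Ioo 0 p) := by
    ext n; have := hp.out.pos; simp; omega
  rw [hr, prod_insert (by simp)] at h
  have h' : ∏ n ∈ Ioo 0 p, ((n : R[X]) + X) = X ^ (p - 1) - 1 := by
    refine monic_X.isRegular.left ?_
    have e : (X : R[X]) * X ^ (p - 1) = X ^ p := by
      rw [← pow_succ', Nat.sub_add_cancel hp.out.one_le]
    simp only [Nat.cast_zero, add_zero] at h
    simp only [mul_sub, mul_one, e, ← h, add_comm]
  simpa [eval_prod] using congrArg (eval u) h'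

theorem prod_Ioo_natCast_sub (hp2 : p ≠ 2) (u : R) :
    ∏ n ∈ Ioo 0 p, ((n : R) - u) = u ^ (p - 1) - 1 := by
  simp_rw [sub_eq_add_neg]
  rw [prod_Ioo_natCast_add, (hp.out.even_sub_one hp2).neg_pow]
  ring

theorem sub_mul_splitSum_of_charP (u v : R) :
    (u - v) * splitSum p u v = u ^ (p - 1) - v ^ (p - 1) := by
  rw [sub_mul_splitSum, prod_Ioo_natCast_add, prod_Ioo_natCast_add]; ring

/-- The behaviour of `splitSumErase` under the reflection `(u, v) ↦ (-z - u, -z - v)`. The two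
hypotheses say that `z` and `u - v` do not lie in the prime field. -/
theorem splitSumErase_reflect [IsDomain R] (hp2 : p ≠ 2) {u v z : R} (hz : z ^ p ≠ z)
    (huv : (u - v) ^ p ≠ u - v) :
    z * (u - v) * (splitSumErase p u v z + splitSumErase p (-z - u) (-z - v) z) =
      (∏ n ∈ Ioo 0 p, ((n : R) - z)) *
        (((u + z) ^ (p - 1) - u ^ (p - 1)) - ((v + z) ^ (p - 1) - v ^ (p - 1))) := by
  set Q := ∏ n ∈ Ioo 0 p, ((n : R) - z)
  -- The difference of the two sides, as a function of `u`.
  let N : R → R := fun u =>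
    z * (u - v) * (splitSumErase p u v z + splitSumErase p (-z - u) (-z - v) z) -
      Q * (((u + z) ^ (p - 1) - u ^ (p - 1)) - ((v + z) ^ (p - 1) - v ^ (p - 1)))
  have hpow : ∀ w : R, w * w ^ (p - 1) = w ^ p := fun w => by
    rw [← pow_succ', Nat.sub_add_cancel hp.out.one_le]
  have hneg : ∀ w : R, (-w) ^ (p - 1) = w ^ (p - 1) := (hp.out.even_sub_one hp2).neg_pow
  have step : ∀ u, (u + 1) * (u - v) * N (u + 1) = (u + z) * (u + 1 - v) * N u := by
    intro u
    have h1 := add_one_mul_splitSumErase p u v z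
    have h2 := add_one_mul_splitSumErase p (-z - (u + 1)) (-z - v) z
    have h3 := sub_mul_splitSum_of_charP (p := p) u v
    have h4 := sub_mul_splitSum_of_charP (p := p) (-z - (u + 1)) (-z - v)
    rw [show -z - (u + 1) + 1 = -z - u by ring] at h2
    rw [show -z - (u + 1) = -(u + 1 + z) by ring, show -z - v = -(v + z) by ring, hneg, hneg] at h4
    rw [show -z - (u + 1) = -(u + 1 + z) by ring, show -z - v = -(v + z) by ring] at h2
    have e1 := hpow (u + 1 + z)
    have e2 := hpow (u + 1)
    have e3 := hpow (u + z)
    have e4 := hpow u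
    have e5 := hpow (v + z)
    have e6 := hpow v
    simp only [add_pow_char, one_pow] at e1 e2 e3 e5
    simp only [N]
    rw [show -z - (u + 1) = -(u + 1 + z) by ring, show -z - v = -(v + z) by ring]
    linear_combination z * (u - v) * (u + 1 - v) * (h1 + h2) + Q * z * (u + 1 - v) * h3
      - Q * z * (u - v) * h4
      - Q * ((u - v) * e1 - (u - v) * e2 - (u + 1 - v) * e3 + (u + 1 - v) * e4 + e5 - e6)
  have iter : ∀ j : ℕ, (∏ n ∈ range j, (u + 1 + n)) * (∏ n ∈ range j, (u - v + n)) * N (u + j) =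
      (∏ n ∈ range j, (u + z + n)) * (∏ n ∈ range j, (u - v + 1 + n)) * N u := by
    intro j
    induction j with
    | zero => simp
    | succ j ih =>
      have h := step (u + j)
      simp only [prod_range_succ]
      push_cast
      rw [← add_assoc]
      linear_combination (∏ n ∈ range j, (u + 1 + (n : R))) * (∏ n ∈ range j, (u - v + (n : R))) * h
        + (u + z + j) * (u - v + 1 + j) * ih
  have h := iter p
  simp only [prod_range_add_natCast, CharP.cast_eq_zero, add_zero, add_pow_char, one_pow] at h
  -- The shift by `p` is trivial, so the two products over a full period must agree on `N u`.
  have h0 : (z ^ p - z) * ((u - v) ^ p - (u - v)) * N u = 0 := by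
    linear_combination -h
  have hN : N u = 0 := by
    simpa [sub_eq_zero, hz, huv] using h0
  exact sub_eq_zero.mp hN

end CharP

/-! ### Multiple sums over chains -/

theorem Ioo_eq_Ico_add_one (a b : ℕ) : Ioo a b = Ico (a + 1) b := by
  ext; simp

section Chains
variable {R : Type*} [CommRing R]

/-- Splitting off the last, hence largest, entry of a chain. The bound `M m` on the remaining entries
is `m` for strictly increasing chains and `m + 1` for weakly increasing ones. -/
theorem sum_chains_succ {d N : ℕ} {P : (Fin d → ℕ) → Prop} {P' : (Fin (d + 1) → ℕ) → Prop}
    [DecidablePred P] [DecidablePred P']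
    {M : ℕ → ℕ} (hM : ∀ m < N, M m ≤ N)
    (hP : ∀ n m, P' (Fin.snoc (α := fun _ => ℕ) n m) ↔ P n ∧ ∀ j, n j < M m)
    (F : Fin (d + 1) → ℕ → R) :
    ∑ n ∈ (Fintype.piFinset fun _ : Fin (d + 1) => Ioo 0 N) with P' n, ∏ j, F j (n j) =
      ∑ m ∈ Ioo 0 N, F (Fin.last d) m *
        ∑ n ∈ (Fintype.piFinset fun _ : Fin d => Ioo 0 (M m)) with P n,
          ∏ j, F j.castSucc (n j) := by
  simp_rw [mul_sum]
  rw [sum_sigma']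
  refine sum_bij' (fun n _ => ⟨n (Fin.last d), Fin.init n⟩)
    (fun x _ => Fin.snoc (α := fun _ => ℕ) x.2 x.1) ?_ ?_ ?_ ?_ ?_
  · intro n hn
    rw [mem_filter, ← Fin.snoc_init_self n, hP] at hn
    simp only [Fintype.mem_piFinset, Fin.forall_fin_succ', Fin.snoc_castSucc, Fin.snoc_last,
      mem_Ioo] at hn
    simp only [mem_sigma, mem_filter, Fintype.mem_piFinset, mem_Ioo]
    exact ⟨hn.1.2, fun j => ⟨(hn.1.1 j).1, hn.2.2 j⟩, hn.2.1⟩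
  · rintro ⟨m, n⟩ hx
    simp only [mem_sigma, mem_filter, Fintype.mem_piFinset, mem_Ioo] at hx
    rw [mem_filter, hP]
    simp only [Fintype.mem_piFinset, Fin.forall_fin_succ', Fin.snoc_castSucc, Fin.snoc_last,
      mem_Ioo]
    exact ⟨⟨fun j => ⟨(hx.2.1 j).1, (hx.2.1 j).2.trans_le (hM m hx.1.2)⟩, hx.1⟩, hx.2.2,
      fun j => (hx.2.1 j).2⟩
  · intro n _
    exact Fin.snoc_init_self n
  · rintro ⟨m, n⟩ _
    simp
  · intro n _
    rw [Fin.prod_univ_castSucc, mul_comm]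
    rfl

theorem strictMono_snoc_iff {d : ℕ} (n : Fin d → ℕ) (m : ℕ) :
    StrictMono (Fin.snoc (α := fun _ => ℕ) n m : Fin (d + 1) → ℕ) ↔
      StrictMono n ∧ ∀ j, n j < m := by
  simp [StrictMono, Fin.forall_fin_succ', Fin.castSucc_lt_last, forall_and, not_lt_of_ge (Fin.le_last _)]

theorem monotone_snoc_iff {d : ℕ} (n : Fin d → ℕ) (m : ℕ) :
    Monotone (Fin.snoc (α := fun _ => ℕ) n m : Fin (d + 1) → ℕ) ↔
      Monotone n ∧ ∀ j, n j < m + 1 := by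
  simp [Monotone, Fin.forall_fin_succ', Fin.le_last, forall_and]

/-- The elementary symmetric polynomial of degree `r` in the `f n` with `n ∈ S`. -/
noncomputable def elemSum (f : ℕ → R) (S : Finset ℕ) (r : ℕ) : R :=
  (∏ n ∈ S, (1 + C (f n) * X)).coeff r

/-- The complete homogeneous symmetric polynomial of degree `r` in the `f n` with `n ∈ S`, as a
coefficient of `∏ 1 / (1 - f n X)`. -/
noncomputable def homSum (f : ℕ → R) (S : Finset ℕ) (r : ℕ) : R :=
  PowerSeries.coeff r (∏ n ∈ S, PowerSeries.mk fun j => f n ^ j)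

theorem elemSum_zero (f : ℕ → R) (S : Finset ℕ) : elemSum f S 0 = 1 := by
  simp [elemSum, coeff_zero_eq_eval_zero, eval_prod]

theorem homSum_zero (f : ℕ → R) (S : Finset ℕ) : homSum f S 0 = 1 := by
  simp [homSum, map_prod, ← PowerSeries.coeff_zero_eq_constantCoeff_apply]

theorem one_sub_mul_mk_pow (a : R) :
    (1 - PowerSeries.C a * PowerSeries.X) * PowerSeries.mk (fun j => a ^ j) = 1 := by
  ext j
  cases j with
  | zero => simp
  | succ j =>
    rw [sub_mul, one_mul, mul_assoc, map_sub, PowerSeries.coeff_C_mul,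
      PowerSeries.coeff_succ_X_mul]
    simp [pow_succ', PowerSeries.coeff_one]

theorem elemSum_succ (f : ℕ → R) (a N r : ℕ) :
    elemSum f (Ico a N) (r + 1) = ∑ m ∈ Ico a N, f m * elemSum f (Ico a m) r := by
  induction N with
  | zero => simp [elemSum, coeff_one]
  | succ N ih =>
    rcases le_or_gt a N with h | h
    · rw [sum_Ico_succ_top h, ← ih, elemSum, prod_Ico_succ_top h, mul_add, mul_one, coeff_add,
        ← mul_assoc, coeff_mul_X, coeff_mul_C, mul_comm (coeff _ r)]
      rfl
    · simp [Ico_eq_empty_of_le (show N + 1 ≤ a from h), elemSum, coeff_one]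

theorem homSum_succ (f : ℕ → R) (a N r : ℕ) :
    homSum f (Ico a N) (r + 1) = ∑ m ∈ Ico a N, f m * homSum f (Ico a (m + 1)) r := by
  induction N with
  | zero => simp [homSum, PowerSeries.coeff_one]
  | succ N ih =>
    rcases le_or_gt a N with h | h
    · rw [sum_Ico_succ_top h, ← ih]
      have key : ∏ n ∈ Ico a N, PowerSeries.mk (fun j => f n ^ j) =
          (∏ n ∈ Ico a (N + 1), PowerSeries.mk (fun j => f n ^ j)) -
            PowerSeries.C (f N) * (PowerSeries.X *
              ∏ n ∈ Ico a (N + 1), PowerSeries.mk (fun j => f n ^ j)) := by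
        rw [prod_Ico_succ_top h]
        linear_combination -(∏ n ∈ Ico a N, PowerSeries.mk (fun j => f n ^ j)) *
          one_sub_mul_mk_pow (f N)
      have := congrArg (PowerSeries.coeff (r + 1)) key
      rw [map_sub, PowerSeries.coeff_C_mul, PowerSeries.coeff_succ_X_mul] at this
      simp only [homSum]
      linear_combination -this
    · simp [Ico_eq_empty_of_le (show N + 1 ≤ a from h), homSum, PowerSeries.coeff_one]

/-- The families `f, …, f, g, f, …` with `g` in position `r`. -/
def marked (f g : ℕ → R) (r j : ℕ) : ℕ → R := if j = r then g else f

open Classical in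
theorem sum_strictMono_eq_elemSum (f g : ℕ → R) {r d : ℕ} (h : d ≤ r) (N : ℕ) :
    ∑ n ∈ (Fintype.piFinset fun _ : Fin d => Ioo 0 N) with StrictMono n,
      ∏ j : Fin d, marked f g r j (n j) = elemSum f (Ico 1 N) d := by
  induction d generalizing N with
  | zero => simp [elemSum_zero, filter_true_of_mem, Subsingleton.strictMono]
  | succ d ih =>
    rw [sum_chains_succ (fun m hm => hm.le) strictMono_snoc_iff fun j => marked f g r j,
      elemSum_succ, Ioo_eq_Ico_add_one]
    refine sum_congr rfl fun m _ => ?_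
    rw [← ih (by omega)]
    simp [marked, (show d ≠ r by omega)]

open Classical in
theorem sum_monotone_eq_homSum (f g : ℕ → R) {r d : ℕ} (h : d ≤ r) (N : ℕ) :
    ∑ n ∈ (Fintype.piFinset fun _ : Fin d => Ioo 0 N) with Monotone n,
      ∏ j : Fin d, marked f g r j (n j) = homSum f (Ico 1 N) d := by
  induction d generalizing N with
  | zero => simp [homSum_zero, filter_true_of_mem, Subsingleton.monotone]
  | succ d ih =>
    rw [sum_chains_succ (M := fun m => m + 1) (fun m hm => hm) monotone_snoc_iff
      fun j => marked f g r j, homSum_succ, Ioo_eq_Ico_add_one]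
    refine sum_congr rfl fun m _ => ?_
    rw [← ih (by omega)]
    simp [marked, (show d ≠ r by omega)]

/-- The sum of `g m` times products of `r` values of `f` below `m` and `s` values of `f` above `m`,
all at pairwise distinct arguments in the open interval from `0` to `N`. -/
noncomputable def markedSum (f g : ℕ → R) (N r s : ℕ) : R :=
  ∑ m ∈ Ico 1 N, g m * (elemSum f (Ico 1 m) r * elemSum f (Ico (m + 1) N) s)

/-- The analogue of `markedSum` for weakly increasing chains: repetitions, also of `m`, are allowed. -/
noncomputable def markedSumStar (f g : ℕ → R) (N r s : ℕ) : R :=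
  ∑ m ∈ Ico 1 N, g m * (homSum f (Ico 1 (m + 1)) r * homSum f (Ico m N) s)

open Classical in
theorem sum_strictMono_eq_markedSum (f g : ℕ → R) (r s N : ℕ) :
    ∑ n ∈ (Fintype.piFinset fun _ : Fin (r + 1 + s) => Ioo 0 N) with StrictMono n,
      ∏ j : Fin (r + 1 + s), marked f g r j (n j) = markedSum f g N r s := by
  induction s generalizing N with
  | zero =>
    rw [sum_chains_succ (fun m hm => hm.le) strictMono_snoc_iff fun j => marked f g r j,
      markedSum, Ioo_eq_Ico_add_one]
    refine sum_congr rfl fun m _ => ?_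
    rw [elemSum_zero, mul_one, ← sum_strictMono_eq_elemSum f g le_rfl]
    simp [marked]
  | succ s ih =>
    refine (sum_chains_succ (d := r + 1 + s) (fun m hm => hm.le) strictMono_snoc_iff
      fun j => marked f g r j).trans ?_
    rw [markedSum, Ioo_eq_Ico_add_one]
    have h1 : ∀ m, ∑ n ∈ (Fintype.piFinset fun _ : Fin (r + 1 + s) => Ioo 0 m) with StrictMono n,
      ∏ j : Fin (r + 1 + s), marked f g r (j.castSucc : Fin (r + 1 + s + 1)) (n j) =
        markedSum f g m r s := fun m => by rw [← ih]; simp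
    have h2 : marked f g r (Fin.last (r + 1 + s)) = f := by
      simp [marked, (show r + 1 + s ≠ r by omega)]
    simp only [h1, h2, markedSum, elemSum_succ, mul_sum]
    rw [sum_comm' (t' := Ico 1 N) (s' := fun m => Ico (m + 1) N) (by simp; omega)]
    refine sum_congr rfl fun m _ => sum_congr rfl fun n _ => by ring

open Classical in
theorem sum_monotone_eq_markedSumStar (f g : ℕ → R) (r s N : ℕ) :
    ∑ n ∈ (Fintype.piFinset fun _ : Fin (r + 1 + s) => Ioo 0 N) with Monotone n,
      ∏ j : Fin (r + 1 + s), marked f g r j (n j) = markedSumStar f g N r s := by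
  induction s generalizing N with
  | zero =>
    rw [sum_chains_succ (M := fun m => m + 1) (fun m hm => hm) monotone_snoc_iff
      fun j => marked f g r j, markedSumStar, Ioo_eq_Ico_add_one]
    refine sum_congr rfl fun m _ => ?_
    rw [homSum_zero, mul_one, ← sum_monotone_eq_homSum f g le_rfl]
    simp [marked]
  | succ s ih =>
    refine (sum_chains_succ (d := r + 1 + s) (M := fun m => m + 1) (fun m hm => hm)
      monotone_snoc_iff fun j => marked f g r j).trans ?_
    rw [markedSumStar, Ioo_eq_Ico_add_one]
    have h1 : ∀ m, ∑ n ∈ (Fintype.piFinset fun _ : Fin (r + 1 + s) => Ioo 0 m) with Monotone n,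
      ∏ j : Fin (r + 1 + s), marked f g r (j.castSucc : Fin (r + 1 + s + 1)) (n j) =
        markedSumStar f g m r s := fun m => by rw [← ih]; simp
    have h2 : marked f g r (Fin.last (r + 1 + s)) = f := by
      simp [marked, (show r + 1 + s ≠ r by omega)]
    simp only [h1, h2, markedSumStar, homSum_succ, mul_sum]
    rw [sum_comm' (t' := Ico 1 N) (s' := fun m => Ico m N) (by simp; omega)]
    refine sum_congr rfl fun m _ => sum_congr rfl fun n _ => by ring

end Chains

/-! ### The two-parameter generating function -/

/-- The generating function `∑ r s, α ^ r * β ^ s * markedSum f g p r s`, in product form; see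
`genSum_eq_sum_markedSum`. -/
def genSum {R : Type*} [CommRing R] (f g : ℕ → R) (p : ℕ) (α β : R) : R :=
  ∑ m ∈ Ioo 0 p, g m * ((∏ n ∈ Ioo 0 m, (1 + α * f n)) * ∏ n ∈ Ioo m p, (1 + β * f n))

/-- Clearing denominators in `genSum` for `f n = x / (n - x)` and `g n = 2 x / (n - 2 x)`. The two
terms on the right come from `(m - x) / (m - 2 x) = 1 + x / (m - 2 x)`. -/
theorem genSum_mul_prod {R : Type*} [CommRing R] {f g : ℕ → R} {p : ℕ} {x : R}
    (hf : ∀ n ∈ Ioo 0 p, (n - x) * f n = x) (hg : ∀ n ∈ Ioo 0 p, (n - 2 * x) * g n = 2 * x)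
    (α β : R) :
    genSum f g p α β * (∏ n ∈ Ioo 0 p, ((n : R) - x)) * (∏ n ∈ Ioo 0 p, ((n : R) - 2 * x)) =
      2 * x * ((∏ n ∈ Ioo 0 p, ((n : R) - 2 * x)) * splitSum p ((α - 1) * x) ((β - 1) * x) +
        x * splitSumErase p ((α - 1) * x) ((β - 1) * x) (2 * x)) := by
  simp only [genSum, splitSum, splitSumErase, mul_sum, sum_mul, ← sum_add_distrib]
  refine sum_congr rfl fun m hm => ?_
  have hm' := mem_Ioo.mp hm
  have hprod : ∀ (S : Finset ℕ) (γ : R), S ⊆ Ioo 0 p →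
      (∏ n ∈ S, ((n : R) - x)) * ∏ n ∈ S, (1 + γ * f n) = ∏ n ∈ S, ((n : R) + (γ - 1) * x) := by
    intro S γ hS
    rw [← prod_mul_distrib]
    exact prod_congr rfl fun n hn => by linear_combination γ * hf n (hS hn)
  have h1 := hprod (Ioo 0 m) α fun n hn => by simp at hn ⊢; omega
  have h2 := hprod (Ioo m p) β fun n hn => by simp at hn ⊢; omega
  have h3 : ∏ n ∈ Ioo 0 p, ((n : R) - x) =
      (m - x) * ((∏ n ∈ Ioo 0 m, ((n : R) - x)) * ∏ n ∈ Ioo m p, ((n : R) - x)) := by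
    have hu : Ioo 0 p = insert m (Ioo 0 m ∪ Ioo m p) := by ext; simp; omega
    rw [hu, prod_insert (by simp), prod_union]
    exact disjoint_left.mpr fun n hn hn' => by simp at hn hn'; omega
  have h4 := mul_prod_erase (Ioo 0 p) (fun n : ℕ => (n : R) - 2 * x) hm
  rw [splitProd, ← h1, ← h2, h3, ← h4]
  linear_combination (m - x) * ((∏ n ∈ Ioo 0 m, ((n : R) - x)) * ∏ n ∈ Ioo m p, ((n : R) - x)) *
    ((∏ n ∈ Ioo 0 m, (1 + α * f n)) * ∏ n ∈ Ioo m p, (1 + β * f n)) *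
    (∏ n ∈ (Ioo 0 p).erase m, ((n : R) - 2 * x)) * hg m hm

/-- The part of `genSum` that is even in `(α, β)` is `x ^ (p - 1)` times an explicit polynomial, up to
factors that do not vanish at `x = 0`. -/
theorem genSum_add_genSum_neg {R : Type*} [CommRing R] [IsDomain R] {p : ℕ} [hp : Fact p.Prime]
    [CharP R p] (hp2 : p ≠ 2) {f g : ℕ → R} {x : R} (hf : ∀ n ∈ Ioo 0 p, (n - x) * f n = x)
    (hg : ∀ n ∈ Ioo 0 p, (n - 2 * x) * g n = 2 * x)
    (hx : (2 * x) ^ p ≠ 2 * x) {α β : R} (hαβ : ((α - β) * x) ^ p ≠ (α - β) * x) :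
    (α - β) * (genSum f g p α β + genSum f g p (-α) (-β)) * ∏ n ∈ Ioo 0 p, ((n : R) - x) =
      x ^ (p - 1) * ((α - 1) ^ (p - 1) - (β - 1) ^ (p - 1) -
        (α + 1) ^ (p - 1) + (β + 1) ^ (p - 1)) := by
  have hx0 : x ≠ 0 := by rintro rfl; simp [hp.out.ne_zero] at hx
  have hQ0 : ∏ n ∈ Ioo 0 p, ((n : R) - 2 * x) ≠ 0 := by
    rw [prod_Ioo_natCast_sub hp2]
    intro h
    refine hx ?_
    rw [← Nat.sub_add_cancel hp.out.one_le, pow_succ, sub_eq_zero.mp h, one_mul]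
  have hsub : (α - 1) * x - (β - 1) * x = (α - β) * x := by ring
  have hT := splitSumErase_reflect (p := p) hp2 (u := (α - 1) * x) (v := (β - 1) * x) hx
    (by rwa [hsub])
  have h1 := genSum_mul_prod hf hg α β
  have h2 := genSum_mul_prod hf hg (-α) (-β)
  have hC1 := sub_mul_splitSum_of_charP (p := p) ((α - 1) * x) ((β - 1) * x)
  have hC2 := sub_mul_splitSum_of_charP (p := p) ((-α - 1) * x) ((-β - 1) * x)
  have hu : ∀ γ : R, -(2 * x) - (γ - 1) * x = (-γ - 1) * x := fun γ => by ring
  have hu' : ∀ γ : R, (γ - 1) * x + 2 * x = (γ + 1) * x := fun γ => by ring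
  have hneg : ∀ γ : R, (-γ - 1) ^ (p - 1) = (γ + 1) ^ (p - 1) := fun γ => by
    rw [← (hp.out.even_sub_one hp2).neg_pow (γ + 1)]; ring
  simp only [hu, hu', mul_pow, hneg] at hT hC1 hC2
  refine mul_left_cancel₀ hx0 (mul_left_cancel₀ hQ0 ?_)
  linear_combination (α - β) * x * h1 + (α - β) * x * h2 + x * hT
    + 2 * x * (∏ n ∈ Ioo 0 p, ((n : R) - 2 * x)) * (hC1 - hC2)


/-! ### Power series over `ZMod p` -/

/-- The power series `∑_{k ≥ 1} a ^ k X ^ k = a X / (1 - a X)`, without constant term. -/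
noncomputable def geomSeries {K : Type*} [CommRing K] (a : K) : PowerSeries K :=
  PowerSeries.mk fun k => if k = 0 then 0 else a ^ k

theorem one_sub_mul_geomSeries {K : Type*} [CommRing K] (a : K) :
    (1 - PowerSeries.C a * PowerSeries.X) * geomSeries a = PowerSeries.C a * PowerSeries.X := by
  have h : geomSeries a = PowerSeries.mk (fun j => a ^ j) - 1 := by
    ext j
    rcases eq_or_ne j 0 with rfl | hj
    · simp [geomSeries]
    · simp [geomSeries, hj, PowerSeries.coeff_one]
  rw [h, mul_sub, one_sub_mul_mk_pow]
  ring

section CoefficientExtraction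
variable {p : ℕ} [hp : Fact p.Prime]

instance : CharP (PowerSeries (ZMod p)) p :=
  charP_of_injective_ringHom (PowerSeries.C_injective (R := ZMod p)) p

theorem natCast_sub_mul_geomSeries (c : ℕ) {n : ℕ} (hn : n ∈ Ioo 0 p) :
    ((n : PowerSeries (ZMod p)) - (c : PowerSeries (ZMod p)) * PowerSeries.X) *
      geomSeries (c * (n : ZMod p)⁻¹) = (c : PowerSeries (ZMod p)) * PowerSeries.X := by
  have hn0 : (n : ZMod p) ≠ 0 := by
    rw [Ne, ZMod.natCast_eq_zero_iff]
    have := mem_Ioo.mp hn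
    exact fun h => absurd (Nat.le_of_dvd this.1 h) (by omega)
  have hn1 : (n : PowerSeries (ZMod p)) * PowerSeries.C (n : ZMod p)⁻¹ = 1 := by
    rw [← map_natCast (PowerSeries.C (R := ZMod p)), ← map_mul, mul_inv_cancel₀ hn0, map_one]
  have h := one_sub_mul_geomSeries ((c : ZMod p) * (n : ZMod p)⁻¹)
  rw [map_mul, map_natCast] at h
  linear_combination (n : PowerSeries (ZMod p)) * h + (c * PowerSeries.X +
    c * PowerSeries.X * geomSeries (c * (n : ZMod p)⁻¹)) * hn1

theorem natCast_sub_X_mul_geomSeries {n : ℕ} (hn : n ∈ Ioo 0 p) :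
    ((n : PowerSeries (ZMod p)) - PowerSeries.X) * geomSeries (n : ZMod p)⁻¹ =
      PowerSeries.X := by
  simpa using natCast_sub_mul_geomSeries 1 hn

theorem natCast_sub_two_mul_X_mul_geomSeries {n : ℕ} (hn : n ∈ Ioo 0 p) :
    ((n : PowerSeries (ZMod p)) - 2 * PowerSeries.X) * geomSeries (2 * (n : ZMod p)⁻¹) =
      2 * PowerSeries.X := by
  simpa using natCast_sub_mul_geomSeries 2 hn

/-- Extracting the coefficient of weight `k` turns the power series `f n = X / (n - X)` and
`g n = 2 X / (n - 2 X)` into the weighted sum over all indices of weight `k`. -/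
theorem coeff_prod_marked (k : ℕ) {d : ℕ} (i : Fin d) (n : Fin d → ℕ) :
    PowerSeries.coeff k (∏ j : Fin d, marked (fun n => geomSeries (n : ZMod p)⁻¹)
      (fun n => geomSeries (2 * (n : ZMod p)⁻¹)) i j (n j)) =
      ∑ κ ∈ indices k d, 2 ^ κ i * ∏ j, ((n j : ZMod p)⁻¹) ^ κ j := by
  have hm : ∀ (j : Fin d) (l : ℕ), PowerSeries.coeff l (marked (fun n => geomSeries (n : ZMod p)⁻¹)
      (fun n => geomSeries (2 * (n : ZMod p)⁻¹)) i j (n j)) =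
      if l = 0 then 0 else (if j = i then 2 ^ l else 1) * ((n j : ZMod p)⁻¹) ^ l := by
    intro j l
    by_cases h : j = i
    · simp [marked, h, geomSeries, mul_pow]
    · simp [marked, h, geomSeries, Fin.val_inj]
  rw [PowerSeries.coeff_prod, indices, sum_filter]
  simp only [hm]
  refine sum_equiv Finsupp.equivFunOnFinite (by simp) fun κ _ => ?_
  simp only [Finsupp.equivFunOnFinite_apply]
  split_ifs with h
  · rw [prod_congr rfl fun j _ => if_neg (Nat.one_le_iff_ne_zero.mp (h j)), prod_mul_distrib]
    simp
  · push Not at h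
    obtain ⟨j, hj⟩ := h
    exact prod_eq_zero (mem_univ j) (if_pos (by omega))

theorem sum_indices_mul_harmonicSum (k : ℕ) {r s : ℕ} (i : Fin (r + 1 + s)) (hi : (i : ℕ) = r) :
    ∑ κ ∈ indices k (r + 1 + s), 2 ^ κ i * harmonicSum p κ = PowerSeries.coeff k
      (markedSum (fun n => geomSeries (n : ZMod p)⁻¹)
        (fun n => geomSeries (2 * (n : ZMod p)⁻¹)) p r s) := by
  rw [← sum_strictMono_eq_markedSum, map_sum]
  simp only [← hi, coeff_prod_marked, harmonicSum, mul_sum]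
  exact sum_comm

theorem sum_indices_mul_harmonicSumStar (k : ℕ) {r s : ℕ} (i : Fin (r + 1 + s))
    (hi : (i : ℕ) = r) :
    ∑ κ ∈ indices k (r + 1 + s), 2 ^ κ i * harmonicSumStar p κ = PowerSeries.coeff k
      (markedSumStar (fun n => geomSeries (n : ZMod p)⁻¹)
        (fun n => geomSeries (2 * (n : ZMod p)⁻¹)) p r s) := by
  rw [← sum_monotone_eq_markedSumStar, map_sum]
  simp only [← hi, coeff_prod_marked, harmonicSumStar, mul_sum]
  exact sum_comm

/-- Over the full range, `∏ (1 + T f n) = ∏ (n + (T - 1) x) / ∏ (n - x)`, which is `1` modulo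
`x ^ (p - 1)`. -/
theorem pow_dvd_elemSum_all (hp2 : p ≠ 2) {j : ℕ} (hj : j ≠ 0) :
    (PowerSeries.X : PowerSeries (ZMod p)) ^ (p - 1) ∣
      elemSum (fun n => geomSeries (n : ZMod p)⁻¹) (Ico 1 p) j := by
  set x : PowerSeries (ZMod p) := PowerSeries.X
  have h : (∏ n ∈ Ioo 0 p, ((n : (PowerSeries (ZMod p))[X]) - C x)) *
      ∏ n ∈ Ioo 0 p, (1 + C (geomSeries (n : ZMod p)⁻¹) * X) =
      ∏ n ∈ Ioo 0 p, ((n : (PowerSeries (ZMod p))[X]) + (X - 1) * C x) := by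
    rw [← prod_mul_distrib]
    refine prod_congr rfl fun n hn => ?_
    have := congrArg C (natCast_sub_X_mul_geomSeries hn)
    rw [map_mul, map_sub, map_natCast] at this
    linear_combination X * this
  rw [prod_Ioo_natCast_sub hp2, prod_Ioo_natCast_add, mul_pow, ← C_pow, ← C_1, ← C_sub,
    Ioo_eq_Ico_add_one, C_1] at h
  have h' := congrArg (coeff · j) h
  simp only [coeff_C_mul, coeff_sub, coeff_mul_C, coeff_one, hj, if_false, sub_zero] at h'
  refine ⟨elemSum (fun n => geomSeries (n : ZMod p)⁻¹) (Ico 1 p) j -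
    ((X - 1 : (PowerSeries (ZMod p))[X]) ^ (p - 1)).coeff j, ?_⟩
  rw [elemSum]
  linear_combination -h'

theorem coeff_prod_one_sub {R : Type*} [CommRing R] (f : ℕ → R) (S : Finset ℕ) (r : ℕ) :
    PowerSeries.coeff r (∏ n ∈ S, (1 - PowerSeries.C (f n) * PowerSeries.X)) =
      (-1) ^ r * elemSum f S r := by
  have h : ∏ n ∈ S, (1 - PowerSeries.C (f n) * PowerSeries.X) =
      (((∏ n ∈ S, (1 + C (f n) * X)).comp (C (-1) * X) : R[X]) : PowerSeries R) := by
    rw [Polynomial.prod_comp, ← coeToPowerSeries.ringHom_apply, map_prod]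
    refine prod_congr rfl fun n _ => ?_
    simp [sub_eq_add_neg]
  rw [h, coeff_coe, comp_C_mul_X_coeff, mul_comm, elemSum]

theorem prod_mk_pow_mul_prod_one_sub {R : Type*} [CommRing R] (f : ℕ → R) (S : Finset ℕ) :
    (∏ n ∈ S, PowerSeries.mk fun j => f n ^ j) *
      ∏ n ∈ S, (1 - PowerSeries.C (f n) * PowerSeries.X) = 1 := by
  rw [← prod_mul_distrib]
  exact prod_eq_one fun n _ => by rw [mul_comm, one_sub_mul_mk_pow]

/-- Modulo `X ^ (p - 1)`, complete homogeneous polynomials over `S` are, up to sign, elementary ones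
over the complement of `S`. -/
theorem pow_dvd_homSum_sub (hp2 : p ≠ 2) {S S' : Finset ℕ} (hS : Disjoint S S')
    (hSS : S ∪ S' = Ico 1 p) (r : ℕ) :
    (PowerSeries.X : PowerSeries (ZMod p)) ^ (p - 1) ∣
      homSum (fun n => geomSeries (n : ZMod p)⁻¹) S r -
        (-1) ^ r * elemSum (fun n => geomSeries (n : ZMod p)⁻¹) S' r := by
  set f : ℕ → PowerSeries (ZMod p) := fun n => geomSeries (n : ZMod p)⁻¹
  have h1 := prod_mk_pow_mul_prod_one_sub f S
  have h2 := prod_union hS (f := fun n => 1 - PowerSeries.C (f n) * PowerSeries.X)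
  rw [hSS] at h2
  rw [homSum, ← coeff_prod_one_sub, ← map_sub]
  have h3 : (∏ n ∈ S, PowerSeries.mk fun j => f n ^ j) -
      ∏ n ∈ S', (1 - PowerSeries.C (f n) * PowerSeries.X) =
      (∏ n ∈ S, PowerSeries.mk fun j => f n ^ j) *
        (1 - ∏ n ∈ Ico 1 p, (1 - PowerSeries.C (f n) * PowerSeries.X)) := by
    rw [h2]
    linear_combination (∏ n ∈ S', (1 - PowerSeries.C (f n) * PowerSeries.X)) * h1
  rw [h3, PowerSeries.coeff_mul]
  refine dvd_sum fun a _ => Dvd.dvd.mul_left ?_ _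
  rw [map_sub, coeff_prod_one_sub, PowerSeries.coeff_one]
  split_ifs with h
  · simp [h, elemSum_zero]
  · rw [zero_sub, dvd_neg]
    exact (pow_dvd_elemSum_all hp2 h).mul_left _

/-- The star sums reduce to the strict ones; the two sides of the marked position are exchanged. -/
theorem pow_dvd_markedSumStar_sub (hp2 : p ≠ 2) (g : ℕ → PowerSeries (ZMod p)) (r s : ℕ) :
    (PowerSeries.X : PowerSeries (ZMod p)) ^ (p - 1) ∣
      markedSumStar (fun n => geomSeries (n : ZMod p)⁻¹) g p r s -
        (-1) ^ (r + s) * markedSum (fun n => geomSeries (n : ZMod p)⁻¹) g p s r := by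
  rw [markedSumStar, markedSum, mul_sum, ← sum_sub_distrib]
  refine dvd_sum fun m hm => ?_
  have hm := mem_Ico.mp hm
  obtain ⟨a, ha⟩ := pow_dvd_homSum_sub hp2 (S := Ico 1 (m + 1)) (S' := Ico (m + 1) p)
    (disjoint_left.mpr fun n hn hn' => by simp at hn hn'; omega) (by ext; simp; omega) r
  obtain ⟨b, hb⟩ := pow_dvd_homSum_sub hp2 (S := Ico m p) (S' := Ico 1 m)
    (disjoint_left.mpr fun n hn hn' => by simp at hn hn'; omega) (by ext; simp; omega) s
  rw [sub_eq_iff_eq_add] at ha hb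
  refine ⟨g m * (a * homSum (fun n => geomSeries (n : ZMod p)⁻¹) (Ico m p) s +
    (-1) ^ r * elemSum (fun n => geomSeries (n : ZMod p)⁻¹) (Ico (m + 1) p) r * b), ?_⟩
  rw [ha, hb]
  ring

theorem prod_one_add_eq_sum_elemSum {R S : Type*} [CommRing R] [CommRing S] (φ : R →+* S)
    (f : ℕ → R) (α : S) {T : Finset ℕ} {M : ℕ} (hM : T.card < M) :
    ∏ n ∈ T, (1 + α * φ (f n)) = ∑ r ∈ range M, φ (elemSum f T r) * α ^ r := by
  have hdeg : (∏ n ∈ T, (1 + C (f n) * X)).natDegree < M := by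
    refine lt_of_le_of_lt ?_ hM
    refine (natDegree_prod_le _ _).trans ?_
    refine (sum_le_card_nsmul _ _ 1 fun n _ => ?_).trans (by simp)
    exact (natDegree_add_le _ _).trans
      (max_le (by simp) ((natDegree_C_mul_le (f n) X).trans natDegree_X_le))
  simp only [elemSum]
  rw [← eval₂_eq_sum_range' φ hdeg, eval₂_finsetProd]
  exact prod_congr rfl fun n _ => by
    rw [eval₂_add, eval₂_one, eval₂_mul, eval₂_C, eval₂_X, mul_comm]

theorem genSum_eq_sum_markedSum {R S : Type*} [CommRing R] [CommRing S] (φ : R →+* S)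
    (f g : ℕ → R) {N M : ℕ} (hM : N < M) (α β : S) :
    genSum (fun n => φ (f n)) (fun n => φ (g n)) N α β =
      ∑ r ∈ range M, ∑ s ∈ range M, α ^ r * β ^ s * φ (markedSum f g N r s) := by
  simp only [genSum, markedSum, Ioo_eq_Ico_add_one, map_sum, mul_sum, map_mul]
  rw [sum_congr rfl fun r _ => sum_comm, sum_comm]
  refine sum_congr rfl fun m hm => ?_
  have hm := mem_Ico.mp hm
  rw [prod_one_add_eq_sum_elemSum φ f α (M := M) (by simp; omega),
    prod_one_add_eq_sum_elemSum φ f β (M := M) (by simp; omega), sum_mul_sum, mul_sum]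
  refine sum_congr rfl fun r _ => ?_
  rw [mul_sum]
  exact sum_congr rfl fun s _ => by ring

theorem pow_dvd_genSum_add_genSum_neg {B : Type*} [CommRing B] [IsDomain B] [CharP B p]
    (hp2 : p ≠ 2) {f g : ℕ → PowerSeries B}
    (hf : ∀ n ∈ Ioo 0 p, ((n : PowerSeries B) - PowerSeries.X) * f n = PowerSeries.X)
    (hg : ∀ n ∈ Ioo 0 p, ((n : PowerSeries B) - 2 * PowerSeries.X) * g n = 2 * PowerSeries.X)
    {a b : B} (hab : a ≠ b) :
    (PowerSeries.X : PowerSeries B) ^ (p - 1) ∣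
      genSum f g p (PowerSeries.C a) (PowerSeries.C b) +
        genSum f g p (-PowerSeries.C a) (-PowerSeries.C b) := by
  have : CharP (PowerSeries B) p :=
    charP_of_injective_ringHom (PowerSeries.C_injective (R := B)) p
  -- A nonzero multiple of the variable is not fixed by Frobenius.
  have hfrob : ∀ c : B, c ≠ 0 →
      (PowerSeries.C c * PowerSeries.X) ^ p ≠ PowerSeries.C c * PowerSeries.X := by
    intro c hc h
    have := congrArg (PowerSeries.coeff 1) h
    rw [mul_pow, ← map_pow, PowerSeries.coeff_C_mul, PowerSeries.coeff_X_pow,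
      if_neg hp.out.one_lt.ne] at this
    simp [hc.symm] at this
  have h2 : (2 : B) ≠ 0 := Ring.two_ne_zero (by rwa [ringChar.eq B p])
  have hsub : PowerSeries.C a - PowerSeries.C b = PowerSeries.C (a - b) := by simp
  have key := genSum_add_genSum_neg hp2 hf hg (by rw [← map_ofNat (PowerSeries.C (R := B)) 2]; exact hfrob 2 h2)
    (by rw [hsub]; exact hfrob _ (sub_ne_zero.mpr hab))
  have hprod : ¬ (PowerSeries.X : PowerSeries B) ∣
      ∏ n ∈ Ioo 0 p, ((n : PowerSeries B) - PowerSeries.X) := by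
    rw [prod_Ioo_natCast_sub hp2, PowerSeries.X_dvd_iff]
    have := hp.out.one_lt
    simp [zero_pow (show p - 1 ≠ 0 by omega)]
  have hα : ¬ (PowerSeries.X : PowerSeries B) ∣ PowerSeries.C a - PowerSeries.C b := by
    rw [hsub, PowerSeries.X_dvd_iff]
    simpa using sub_ne_zero.mpr hab
  exact PowerSeries.X_prime.pow_dvd_of_dvd_mul_left _ hα
    (PowerSeries.X_prime.pow_dvd_of_dvd_mul_right _ hprod (Dvd.intro _ key.symm))

theorem coeff_coeff_sum_C_X_pow_mul {R : Type*} [CommRing R] (c : ℕ → ℕ → R) {M r s : ℕ}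
    (hr : r < M) (hs : s < M) :
    ((∑ a ∈ range M, ∑ b ∈ range M, (C X : R[X][X]) ^ a * X ^ b * C (C (c a b))).coeff s).coeff r =
      c r s := by
  have hterm : ∀ a b : ℕ, (((C X : R[X][X]) ^ a * X ^ b * C (C (c a b))).coeff s).coeff r =
      if r = a then (if s = b then c a b else 0) else 0 := by
    intro a b
    rw [coeff_mul_C, ← C_pow, coeff_C_mul, coeff_X_pow, coeff_mul_C]
    split_ifs <;> simp [coeff_X_pow, *]
  simp only [finsetSum_coeff, hterm]
  simp [hr, hs]

/-- The generating function is considered with two independent polynomial variables `C X` and `X` as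
`α` and `β`; the coefficient of `α ^ r * β ^ s` in its even part is `2 * markedSum f g p r s`. -/
theorem pow_dvd_markedSum (hp2 : p ≠ 2) {r s : ℕ} (hrs : Even (r + s)) :
    (PowerSeries.X : PowerSeries (ZMod p)) ^ (p - 1) ∣
      markedSum (fun n => geomSeries (n : ZMod p)⁻¹)
        (fun n => geomSeries (2 * (n : ZMod p)⁻¹)) p r s := by
  let φ : PowerSeries (ZMod p) →+* PowerSeries (ZMod p)[X][X] := PowerSeries.map (C.comp C)
  have h2 : (2 : ZMod p) ≠ 0 := Ring.two_ne_zero (by rwa [ZMod.ringChar_zmod_n])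
  have hab : (C X : (ZMod p)[X][X]) ≠ X := by
    intro h
    simpa using congrArg (coeff · 1) h
  have hφX : φ PowerSeries.X = PowerSeries.X := PowerSeries.map_X _
  have hf : ∀ n ∈ Ioo 0 p, ((n : PowerSeries (ZMod p)[X][X]) - PowerSeries.X) *
      φ (geomSeries (n : ZMod p)⁻¹) = PowerSeries.X := fun n hn => by
    rw [← hφX, ← map_natCast φ, ← map_sub, ← map_mul, natCast_sub_X_mul_geomSeries hn]
  have hg : ∀ n ∈ Ioo 0 p, ((n : PowerSeries (ZMod p)[X][X]) - 2 * PowerSeries.X) *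
      φ (geomSeries (2 * (n : ZMod p)⁻¹)) = 2 * PowerSeries.X := fun n hn => by
    rw [← hφX, ← map_natCast φ, ← map_ofNat φ, ← map_mul, ← map_sub, ← map_mul,
      natCast_sub_two_mul_X_mul_geomSeries hn]
  have hdvd := pow_dvd_genSum_add_genSum_neg (p := p) hp2 hf hg hab
  have hM : p < p + r + s + 1 := by omega
  rw [genSum_eq_sum_markedSum φ _ _ hM, genSum_eq_sum_markedSum φ _ _ hM,
    ← sum_add_distrib, PowerSeries.X_pow_dvd_iff] at hdvd
  rw [PowerSeries.X_pow_dvd_iff]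
  intro k hk
  set c : ℕ → ℕ → ZMod p := fun a b => PowerSeries.coeff k
    (markedSum (fun n => geomSeries (n : ZMod p)⁻¹)
        (fun n => geomSeries (2 * (n : ZMod p)⁻¹)) p a b) with hc
  set α : PowerSeries (ZMod p)[X][X] := PowerSeries.C (C X)
  set β : PowerSeries (ZMod p)[X][X] := PowerSeries.C X
  have hterm : ∀ a b : ℕ, ∀ Φ : PowerSeries (ZMod p), PowerSeries.coeff k
      (α ^ a * β ^ b * φ Φ +
        (-α) ^ a * (-β) ^ b * φ Φ) =
      (C X : (ZMod p)[X][X]) ^ a * X ^ b *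
        C (C ((1 + (-1) ^ (a + b)) * PowerSeries.coeff k Φ)) := by
    intro a b Φ
    have : α ^ a * β ^ b * φ Φ +
        (-α) ^ a * (-β) ^ b * φ Φ =
        PowerSeries.C ((C X : (ZMod p)[X][X]) ^ a * X ^ b * C (C (1 + (-1) ^ (a + b)))) *
          φ Φ := by
      rw [neg_pow (α), neg_pow (β)]
      simp only [α, β, map_mul, map_pow, map_add, map_one, map_neg]
      ring
    rw [this, PowerSeries.coeff_C_mul]
    simp only [φ, PowerSeries.coeff_map, RingHom.comp_apply, map_mul]
    ring
  have h := hdvd k hk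
  simp only [← sum_add_distrib, map_sum, hterm] at h
  have h' := coeff_coeff_sum_C_X_pow_mul (fun a b => (1 + (-1) ^ (a + b)) * c a b)
    (M := p + r + s + 1) (r := r) (s := s) (by omega) (by omega)
  rw [h, hrs.neg_one_pow, one_add_one_eq_two] at h'
  simpa [h2] using h'.symm

end CoefficientExtraction

/-- A family whose component at `p` vanishes for all `p > K` is zero in `𝒜`. -/
theorem mk_eq_zero_of_forall_gt {F : ∀ p : Nat.Primes, ZMod (p : ℕ)} (K : ℕ)
    (h : ∀ p : Nat.Primes, K < p → F p = 0) : Ideal.Quotient.mk directSumIdeal F = 0 := by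
  rw [Ideal.Quotient.eq_zero_iff_mem]
  refine Set.Finite.subset ((Set.finite_Iic K).preimage Nat.Primes.coe_nat_injective.injOn) ?_
  intro p hp
  by_contra hK
  exact hp (h p (by simpa using hK))

end FiniteMZV

theorem theorem2 (k d : ℕ) (hk : 1 ≤ k) (hd : Odd d) (i : Fin d) :
    (∑ κ ∈ FiniteMZV.indices k d, (2 : FiniteMZV.A) ^ κ i * FiniteMZV.zetaA κ = 0) ∧
      (∑ κ ∈ FiniteMZV.indices k d, (2 : FiniteMZV.A) ^ κ i * FiniteMZV.zetaAStar κ = 0) := by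
  obtain ⟨r, hr⟩ := i
  obtain ⟨s, rfl⟩ : ∃ s, d = r + 1 + s := ⟨d - 1 - r, by omega⟩
  have hrs : Even (r + s) := by
    rw [add_right_comm] at hd
    simpa [Nat.odd_add_one] using hd
  have hmk : (2 : FiniteMZV.A) = Ideal.Quotient.mk FiniteMZV.directSumIdeal 2 :=
    (map_ofNat _ 2).symm
  constructor
  · simp only [FiniteMZV.zetaA, hmk, ← map_pow, ← map_mul, ← map_sum]
    refine FiniteMZV.mk_eq_zero_of_forall_gt (k + 1) fun p hp => ?_
    have : Fact (p : ℕ).Prime := ⟨p.2⟩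
    have h := FiniteMZV.pow_dvd_markedSum (p := (p : ℕ)) (by omega) hrs
    rw [PowerSeries.X_pow_dvd_iff] at h
    simpa [FiniteMZV.sum_indices_mul_harmonicSum] using h k (by omega)
  · simp only [FiniteMZV.zetaAStar, hmk, ← map_pow, ← map_mul, ← map_sum]
    refine FiniteMZV.mk_eq_zero_of_forall_gt (k + 1) fun p hp => ?_
    have : Fact (p : ℕ).Prime := ⟨p.2⟩
    have h := (dvd_sub_left ((FiniteMZV.pow_dvd_markedSum (p := (p : ℕ)) (by omega)
      (add_comm r s ▸ hrs)).mul_left _)).mp (FiniteMZV.pow_dvd_markedSumStar_sub (by omega) _ r s)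
    rw [PowerSeries.X_pow_dvd_iff] at h
    simpa [FiniteMZV.sum_indices_mul_harmonicSumStar] using h k (by omega)
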